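/- **Setting.** Let $X=\begin{pmatrix}A&B\\C&D\end{pmatrix}\in\mathbb R^{(n+p)\times(n+m)}$ with $A\in\mathbb R^{n\times n}$, $D\in\mathbb R^{p\times m}$, and let $L:\mathbb R^{k\times l}\to\mathbb R^{(n+p)\times(n+m)}$ be linear. Let $M(X)\in\mathbb R^{2n\times 2n}$ be either (for $p=m$ and $D+D^\top$ positive definite) $$M_p(X)=\begin{pmatrix}A&0\\0&-A^\top\end{pmatrix}-\begin{pmatrix}B\\-C^\top\end{pmatrix}(D+D^\top)^{-1}\begin{pmatrix}C^\top\\B\end{pmatrix}^{\top}$$ or (for $I-D^\top D$ positive definite) $$M_b(X)=\begin{pmatrix}A&0\\-C^\top C&-A^\top\end{pmatrix}+\begin{pmatrix}B\\-C^\top D\end{pmatrix}(I-D^\top D)^{-1}\begin{pmatrix}C^\top D\\B\end{pmatrix}^{\top}.$$ For $\varepsilon>0$ and $E\in\mathbb R^{k\times l}$ let $\phi_\varepsilon(E)=\operatorname{Re}\lambda(M(X+L[\varepsilon E]))$, where $\lambda(M)$ is the eigenvalue of $M$ of minimal nonnegative real part and, among these, with largest imaginary part. Let $0\le\varepsilon_0<\widehat\varepsilon$.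 For $\varepsilon\in(\varepsilon_0,\widehat\varepsilon)$ let $E(\varepsilon)$ with $\|E(\varepsilon)\|_F=1$ be a local minimizer of $\phi_\varepsilon$ on the unit sphere of the Frobenius norm such that the positive definiteness condition that defines $M$ holds for $X+L[\varepsilon E(\varepsilon)]$, put $M(\varepsilon)=M(X+L[\varepsilon E(\varepsilon)])$ and $\lambda(\varepsilon)=\lambda(M(\varepsilon))$, and suppose $\operatorname{Re}\lambda(\varepsilon)>0$. Let $x(\varepsilon),y(\varepsilon)\in\mathbb C^{2n}$ be left and right eigenvectors of $M(\varepsilon)$ to $\lambda(\varepsilon)$ of Euclidean norm $1$ with $x(\varepsilon)^*y(\varepsilon)$ real and positive, and let $$G(\varepsilon)=L^*\,M'(X+L[\varepsilon E(\varepsilon)])^*\bigl[\operatorname{Re}(x(\varepsilon)y(\varepsilon)^*)\bigr]\in\mathbb R^{k\times l},$$ where $M'$ is the derivative of $M$ and the adjoints are taken for the Frobenius inner products. **Theorem.** Assume: 1. For $\varepsilon\in(\varepsilon_0,\widehat\varepsilon)$, $\lambda(\varepsilon)$ is a simple eigenvalue and the only eigenvalue of $M(\varepsilon)$ of real part $\operatorname{Re}\lambda(\varepsilon)$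 and nonnegative imaginary part, and $E$ and $\lambda$ are smooth on $(\varepsilon_0,\widehat\varepsilon)$. 2. $G(\varepsilon)\neq0$ for $\varepsilon\in(\varepsilon_0,\widehat\varepsilon)$, and the limit $G(\widehat\varepsilon)=\lim_{\varepsilon\nearrow\widehat\varepsilon}G(\varepsilon)$ exists and is nonzero. 3. The limits $M(\widehat\varepsilon)=\lim_{\varepsilon\nearrow\widehat\varepsilon}M(\varepsilon)$ and $\lambda(\widehat\varepsilon)=\lim_{\varepsilon\nearrow\widehat\varepsilon}\lambda(\varepsilon)$ exist, $\operatorname{Re}\lambda(\widehat\varepsilon)=0$, and the eigenvalue $\lambda(\widehat\varepsilon)$ of $M(\widehat\varepsilon)$ has algebraic multiplicity two and is defective, i.e. has geometric multiplicity one. 4. (Nondegeneracy.) With $J=\begin{pmatrix}0&I_n\\-I_n&0\end{pmatrix}$, for $\varepsilon\in(\varepsilon_0,\widehat\varepsilon)$ there are real $S(\varepsilon)$ with $S^\top S=I$, $S^\top JS=J$ and $$S(\varepsilon)^{-1}M(\varepsilon)S(\varepsilon)=\begin{pmatrix}F(\varepsilon)&H(\varepsilon)\\0&-F(\varepsilon)^\top\end{pmatrix},$$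 $F(\varepsilon)$ upper quasi-triangular, $H(\varepsilon)$ symmetric, such that, writing $S(\varepsilon)^{-1}y(\varepsilon)=\begin{pmatrix}-p(\varepsilon)\\0\end{pmatrix}$ and $S(\varepsilon)^{\top}x(\varepsilon)=\begin{pmatrix}-s(\varepsilon)\\r(\varepsilon)\end{pmatrix}$ with blocks in $\mathbb C^n$, $$\liminf_{\varepsilon\nearrow\widehat\varepsilon}\left|\left(\frac{s(\varepsilon)}{\|s(\varepsilon)\|}\right)^{*}\frac{r(\varepsilon)}{\|r(\varepsilon)\|}\right|>0 .$$ Then there is a constant $\gamma>0$ such that $$\operatorname{Re}\lambda(\varepsilon)=\gamma\sqrt{\widehat\varepsilon-\varepsilon}\,(1+o(1))\qquad\text{as }\varepsilon\nearrow\widehat\varepsilon .$$ -/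

import Mathlib

open Filter Topology Asymptotics Set Matrix
open scoped ContDiff

-- All real matrix spaces carry the Frobenius norm.
attribute [local instance] Matrix.frobeniusNormedAddCommGroup Matrix.frobeniusNormedSpace

noncomputable section

namespace Passivation

/-- Real system matrices `X = (A B; C D)` with `A` of size `n × n`, `B` of size `n × m`,
`C` of size `p × n` and `D` of size `p × m`. -/
abbrev SystemMatrix (n p m : ℕ) := Matrix (Fin n ⊕ Fin p) (Fin n ⊕ Fin m) ℝ

/-- Real `2n × 2n` matrices, partitioned into `n × n` blocks. -/
abbrev StateMatrix (n : ℕ) := Matrix (Fin n ⊕ Fin n) (Fin n ⊕ Fin n) ℝ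

/-- The Hamiltonian matrix of a square system for passivity in the immittance representation
(positive realness). -/
def immittanceHamiltonian {n m : ℕ} (X : SystemMatrix n m m) : StateMatrix n :=
  let A := X.toBlocks₁₁
  let B := X.toBlocks₁₂
  let C := X.toBlocks₂₁
  let D := X.toBlocks₂₂
  fromBlocks A 0 0 (-Aᵀ) - fromRows B (-Cᵀ) * (D + Dᵀ)⁻¹ * (fromRows Cᵀ B)ᵀ

/-- The Hamiltonian matrix of a system for passivity in the scattering representation
(bounded realness). -/
def scatteringHamiltonian {n p m : ℕ} (X : SystemMatrix n p m) : StateMatrix n :=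
  let A := X.toBlocks₁₁
  let B := X.toBlocks₁₂
  let C := X.toBlocks₂₁
  let D := X.toBlocks₂₂
  fromBlocks A 0 (-(Cᵀ * C)) (-Aᵀ)
    + fromRows B (-(Cᵀ * D)) * (1 - Dᵀ * D)⁻¹ * (fromRows (Cᵀ * D) B)ᵀ

/-- The two notions of passivity, for systems with `p` outputs and `m` inputs. The immittance
notion exists only for `p = m`. -/
inductive PassivityNotion : ℕ → ℕ → Type
  | immittance (m : ℕ) : PassivityNotion m m
  | scattering (p m : ℕ) : PassivityNotion p m

/-- The Hamiltonian matrix `M(X)` belonging to a notion of passivity. -/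
def PassivityNotion.hamiltonian {n : ℕ} :
    {p m : ℕ} → PassivityNotion p m → SystemMatrix n p m → StateMatrix n
  | _, _, .immittance _, X => immittanceHamiltonian X
  | _, _, .scattering _ _, X => scatteringHamiltonian X

/-- The condition on the feedthrough block `D` under which `M(X)` is defined: `D + Dᵀ`,
respectively `I - Dᵀ D`, is positive definite. -/
def PassivityNotion.Admissible {n : ℕ} :
    {p m : ℕ} → PassivityNotion p m → SystemMatrix n p m → Prop
  | _, _, .immittance _, X => (X.toBlocks₂₂ + X.toBlocks₂₂ᵀ).PosDef
  | _, _, .scattering _ _, X => (1 - X.toBlocks₂₂ᵀ * X.toBlocks₂₂).PosDef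

/-- A real matrix regarded as a complex matrix. -/
abbrev toComplex {ι κ : Type*} (M : Matrix ι κ ℝ) : Matrix ι κ ℂ := M.map Complex.ofReal

/-- `μ` is the eigenvalue of `M` of minimal nonnegative real part, among these the one with the
largest imaginary part. -/
def IsLeadingEigenvalue {n : ℕ} (M : StateMatrix n) (μ : ℂ) : Prop :=
  μ ∈ spectrum ℂ (toComplex M) ∧ 0 ≤ μ.re ∧
    ∀ μ' ∈ spectrum ℂ (toComplex M), 0 ≤ μ'.re →
      μ.re < μ'.re ∨ (μ.re = μ'.re ∧ μ'.im ≤ μ.im)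

/-- The minimal nonnegative real part of an eigenvalue of `M`. -/
def minRealPart {n : ℕ} (M : StateMatrix n) : ℝ :=
  sInf (Complex.re '' {μ ∈ spectrum ℂ (toComplex M) | 0 ≤ μ.re})

/-- The real part of a leading eigenvalue is the minimal nonnegative real part. -/
theorem IsLeadingEigenvalue.minRealPart_eq {n : ℕ} {M : StateMatrix n} {μ : ℂ}
    (h : IsLeadingEigenvalue M μ) : minRealPart M = μ.re := by
  apply IsLeast.csInf_eq
  refine ⟨⟨μ, ⟨h.1, h.2.1⟩, rfl⟩, ?_⟩
  rintro _ ⟨μ', ⟨h1, h2⟩, rfl⟩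
  rcases h.2.2 μ' h1 h2 with h3 | h3
  · exact h3.le
  · exact h3.1.le

/-- The functional `φ_ε(E) = Re λ(M(X + L[ε E]))`. -/
def phi {n p m k l : ℕ} (ν : PassivityNotion p m) (X : SystemMatrix n p m)
    (L : Matrix (Fin k) (Fin l) ℝ →ₗ[ℝ] SystemMatrix n p m) (ε : ℝ)
    (E : Matrix (Fin k) (Fin l) ℝ) : ℝ :=
  minRealPart (ν.hamiltonian (X + L (ε • E)))

/-- `x` and `y` are left and right eigenvectors of `M` to `μ`, of Euclidean norm `1` and such that
`x* y` is real and positive. -/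
structure IsNormalizedEigenpair {n : ℕ} (M : StateMatrix n) (μ : ℂ)
    (x y : Fin n ⊕ Fin n → ℂ) : Prop where
  left : star x ᵥ* toComplex M = μ • star x
  right : toComplex M *ᵥ y = μ • y
  norm_left : ‖WithLp.toLp 2 x‖ = 1
  norm_right : ‖WithLp.toLp 2 y‖ = 1
  im_eq_zero : (star x ⬝ᵥ y).im = 0
  re_pos : 0 < (star x ⬝ᵥ y).re

/-- The Frobenius inner product `⟨U, V⟩ = tr (Uᵀ V)`. -/
def frobInner {ι κ : Type*} [Fintype ι] [Fintype κ] (U V : Matrix ι κ ℝ) : ℝ :=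
  (Uᵀ * V).trace

/-- The adjoint of a linear map between spaces of real matrices with respect to the Frobenius
inner products. -/
def frobAdjoint {ι κ ι' κ' : Type*} [Fintype ι'] [Fintype κ'] [DecidableEq ι] [DecidableEq κ]
    (T : Matrix ι κ ℝ →ₗ[ℝ] Matrix ι' κ' ℝ) (V : Matrix ι' κ' ℝ) : Matrix ι κ ℝ :=
  Matrix.of fun i j => frobInner (T (Matrix.single i j 1)) V

theorem frobInner_eq_sum {ι κ : Type*} [Fintype ι] [Fintype κ] (U V : Matrix ι κ ℝ) :
    frobInner U V = ∑ i, ∑ j, U i j * V i j := by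
  rw [Finset.sum_comm]
  simp [frobInner, Matrix.trace, Matrix.mul_apply]

/-- The defining property of the adjoint. -/
theorem frobInner_frobAdjoint {ι κ ι' κ' : Type*} [Fintype ι] [Fintype κ] [Fintype ι']
    [Fintype κ'] [DecidableEq ι] [DecidableEq κ]
    (T : Matrix ι κ ℝ →ₗ[ℝ] Matrix ι' κ' ℝ) (U : Matrix ι κ ℝ) (V : Matrix ι' κ' ℝ) :
    frobInner (T U) V = frobInner U (frobAdjoint T V) := by
  have hT : T U = ∑ i, ∑ j, U i j • T (Matrix.single i j 1) := by
    conv_lhs => rw [Matrix.matrix_eq_sum_single U]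
    simp only [map_sum]
    refine Finset.sum_congr rfl fun i _ => Finset.sum_congr rfl fun j _ => ?_
    rw [← map_smul, Matrix.smul_single, smul_eq_mul, mul_one]
  rw [frobInner_eq_sum U]
  simp only [frobAdjoint, Matrix.of_apply, frobInner, hT, Matrix.transpose_sum,
    Matrix.transpose_smul, Matrix.smul_mul, Matrix.trace_sum, Matrix.trace_smul,
    smul_eq_mul, Matrix.sum_mul]

/-- The (rescaled) gradient `G_ε(E) = L* M'(X + L[ε E])* [Re (x y*)]`. -/
def freeGradient {n p m k l : ℕ} (ν : PassivityNotion p m) (X : SystemMatrix n p m)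
    (L : Matrix (Fin k) (Fin l) ℝ →ₗ[ℝ] SystemMatrix n p m) (ε : ℝ)
    (E : Matrix (Fin k) (Fin l) ℝ) (x y : Fin n ⊕ Fin n → ℂ) : Matrix (Fin k) (Fin l) ℝ :=
  frobAdjoint L
    (frobAdjoint (fderiv ℝ ν.hamiltonian (X + L (ε • E))).toLinearMap
      ((vecMulVec x (star y)).map Complex.re))

/-- Block upper triangular with diagonal blocks of size `1` or `2`. -/
def IsUpperQuasiTriangular {n : ℕ} (F : Matrix (Fin n) (Fin n) ℝ) : Prop :=
  (∀ i j : Fin n, (j : ℕ) + 1 < i → F i j = 0) ∧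
    ∀ i j k : Fin n, (j : ℕ) = i + 1 → (k : ℕ) = j + 1 → F j i = 0 ∨ F k j = 0

/-- `S` is a real orthogonal symplectic matrix that transforms `M` to a block triangular Hamiltonian
matrix (a real Schur–Hamiltonian decomposition). -/
def IsSchurHamiltonian {n : ℕ} (M S : StateMatrix n) : Prop :=
  S ∈ Matrix.orthogonalGroup (Fin n ⊕ Fin n) ℝ ∧ S ∈ Matrix.symplecticGroup (Fin n) ℝ ∧
    ∃ F H : Matrix (Fin n) (Fin n) ℝ, IsUpperQuasiTriangular F ∧ H.IsSymm ∧
      S⁻¹ * M * S = fromBlocks F H 0 (-Fᵀ)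

/-- The modulus of the inner product of the normalizations of two complex vectors. -/
def normalizedInner {n : ℕ} (s r : Fin n → ℂ) : ℝ :=
  ‖inner ℂ ((‖WithLp.toLp 2 s‖⁻¹ : ℂ) • WithLp.toLp 2 s)
    ((‖WithLp.toLp 2 r‖⁻¹ : ℂ) • WithLp.toLp 2 r)‖

/-- The nondegeneracy condition as `ε ↗ b`: in coordinates of real Schur–Hamiltonian
decompositions, in which the right eigenvector is `(-p; 0)` and the left eigenvector is `(-s; r)`,
the normalizations of `s` and `r` are not asymptotically orthogonal. -/
def NondegeneracyCondition {n : ℕ} (a b : ℝ) (M : ℝ → StateMatrix n) (x y : ℝ → Fin n ⊕ Fin n → ℂ) :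
    Prop :=
  ∃ (S : ℝ → StateMatrix n) (s r p : ℝ → Fin n → ℂ),
    (∀ ε ∈ Ioo a b, IsSchurHamiltonian (M ε) (S ε) ∧
      toComplex (S ε)ᵀ *ᵥ x ε = Sum.elim (-s ε) (r ε) ∧
      toComplex (S ε)⁻¹ *ᵥ y ε = Sum.elim (-p ε) 0) ∧
    0 < liminf (fun ε => normalizedInner (s ε) (r ε)) (𝓝[<] b)

end Passivation

end

open Passivation

/-! Write f = Re λ, κ = x*y, and p for the characteristic polynomial of M(ε). The proof computes the
limit of f f'.

Stationarity on the sphere forces G to be a real multiple of E. Since E' is tangential,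
differentiating the simple eigenvalue leaves f' κ = ⟨E, G⟩, hence |f'| κ = ‖G‖
(`frobInner_freeGradient_eq_zero`, `re_mul_eq_frobInner_freeGradient`, `sq_frobInner_eq_norm_sq`).
As G never vanishes and f is positive with limit 0, f' is negative, so f' = -‖G‖/κ.

It remains to compare κ with f (`exists_tendsto_re_div_dotProduct`). At a simple eigenvalue adj(λ -
M) = α y x* with α κ = tr adj(λ - M) = p'(λ) and |α| = ‖adj(λ - M)‖. Hamiltonian symmetry makes
-conj λ a second root, at distance 2f from λ, so p'(λ) = 2f R. At the coalescence R tends to half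
the second derivative of the limiting characteristic polynomial, nonzero because the algebraic
multiplicity is two. The adjugate also has a nonzero limit, because geometric multiplicity one means
corank one. Therefore f/κ tends to some c > 0.

Consequently f f' = -(f/κ)‖G‖ has a negative limit, and L'Hôpital's rule applied to f²/(εhat - ε)
gives the square root law (`isEquivalent_sqrt`). -/

noncomputable section

namespace Passivation

/-! ### Adjugates of matrices of corank one -/

section Adjugate

variable {ι K : Type*} [Fintype ι] [DecidableEq ι] [Field K]

theorem adjugate_mul_mul_eq_zero_iff {P Q : Matrix ι ι K} (hP : IsUnit P) (hQ : IsUnit Q)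
    (A : Matrix ι ι K) : (P * A * Q).adjugate = 0 ↔ A.adjugate = 0 := by
  have key : ∀ {P : Matrix ι ι K}, IsUnit P → IsUnit P.adjugate := by
    intro P hP
    rw [Matrix.isUnit_iff_isUnit_det] at hP ⊢
    rw [Matrix.det_adjugate]
    exact hP.pow _
  rw [Matrix.adjugate_mul_distrib, Matrix.adjugate_mul_distrib, (key hQ).mul_right_eq_zero,
    (key hP).mul_left_eq_zero]

/-- The i-th diagonal entry of the adjugate is the product of all D j with j ≠ i, which is nonzero
exactly when D has no zero outside i. -/
theorem adjugate_diagonal_ne_zero_iff [Nonempty ι] (D : ι → K) :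
    (diagonal D).adjugate ≠ 0 ↔ Fintype.card ι ≤ (diagonal D).rank + 1 := by
  classical
  have hcard : Fintype.card ι ≤ (diagonal D).rank + 1 ↔ Fintype.card {i // D i = 0} ≤ 1 := by
    rw [Matrix.rank_diagonal]
    have := Fintype.card_subtype_compl (fun i => D i = 0)
    have h2 := Fintype.card_subtype_le (fun i => D i = 0)
    simp only [ne_eq] at this ⊢
    omega
  rw [hcard, Matrix.adjugate_diagonal, Fintype.card_le_one_iff, Ne, Matrix.diagonal_eq_zero,
    funext_iff, not_forall]
  simp only [Pi.zero_apply, Finset.prod_eq_zero_iff, not_exists, not_and, Finset.mem_erase,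
    Finset.mem_univ, and_true, Subtype.forall, Subtype.mk.injEq]
  constructor
  · rintro ⟨i, hi⟩ a ha b hb
    have h1 : a = i := by by_contra h; exact hi a h ha
    have h2 : b = i := by by_contra h; exact hi b h hb
    rw [h1, h2]
  · intro h
    by_cases hex : ∃ i, D i = 0
    · obtain ⟨i, hi⟩ := hex
      exact ⟨i, fun j hj h0 => hj (h j h0 i hi)⟩
    · push Not at hex
      exact ⟨Classical.arbitrary ι, fun j _ => hex j⟩

/-- The adjugate is nonzero exactly for matrices of corank at most one. -/
theorem adjugate_ne_zero_iff [Nonempty ι] (A : Matrix ι ι K) :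
    A.adjugate ≠ 0 ↔ Fintype.card ι ≤ A.rank + 1 := by
  -- Transvections are invertible, so they change neither the rank nor whether the adjugate
  -- vanishes; only the diagonal case remains.
  obtain ⟨L, L', D, rfl⟩ := Matrix.Pivot.exists_list_transvec_mul_diagonal_mul_list_transvec A
  have hL := TransvectionStruct.det_toMatrix_prod L
  have hL' := TransvectionStruct.det_toMatrix_prod L'
  rw [Ne, adjugate_mul_mul_eq_zero_iff (by simp [Matrix.isUnit_iff_isUnit_det, hL])
    (by simp [Matrix.isUnit_iff_isUnit_det, hL']),
    Matrix.rank_mul_eq_left_of_isUnit_det _ _ (by simp [hL']),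
    Matrix.rank_mul_eq_right_of_isUnit_det _ _ (by simp [hL])]
  exact adjugate_diagonal_ne_zero_iff D

theorem finrank_ker_mulVecLin_add_rank {ι K : Type*} [Fintype ι] [Field K] (A : Matrix ι ι K) :
    A.rank + Module.finrank K (LinearMap.ker A.mulVecLin) = Fintype.card ι := by
  rw [Matrix.rank, LinearMap.finrank_range_add_finrank_ker, Module.finrank_pi]

/-- If the adjugate is nonzero, then the kernel is spanned by any of its nonzero elements. -/
theorem exists_smul_eq_of_adjugate_ne_zero {A : Matrix ι ι K} (hA : A.adjugate ≠ 0)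
    {y v : ι → K} (hy : A *ᵥ y = 0) (hy0 : y ≠ 0) (hv : A *ᵥ v = 0) : ∃ c : K, c • y = v := by
  have : Nonempty ι := by
    by_contra h
    rw [not_nonempty_iff] at h
    exact hy0 (Subsingleton.elim _ _)
  have h1 := (adjugate_ne_zero_iff A).1 hA
  have h2 := finrank_ker_mulVecLin_add_rank A
  have h3 : Module.finrank K (LinearMap.ker A.mulVecLin) ≤ 1 := by omega
  obtain ⟨w, hw⟩ := finrank_le_one_iff.1 h3
  obtain ⟨a, ha⟩ := hw ⟨y, by simpa using hy⟩
  obtain ⟨b, hb⟩ := hw ⟨v, by simpa using hv⟩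
  have ha' : a • (w : ι → K) = y := congrArg Subtype.val ha
  have hb' : b • (w : ι → K) = v := congrArg Subtype.val hb
  have ha0 : a ≠ 0 := by
    rintro rfl
    exact hy0 (by rw [← ha', zero_smul])
  exact ⟨b / a, by rw [← ha', ← hb', smul_smul, div_mul_cancel₀ _ ha0]⟩

/-- A nonzero adjugate of a singular matrix is the product of a right and a left null vector. -/
theorem exists_adjugate_eq_smul_vecMulVec {A : Matrix ι ι K} (hA : A.adjugate ≠ 0)
    {x y : ι → K} (hy : A *ᵥ y = 0) (hy0 : y ≠ 0) (hx : x ᵥ* A = 0) (hx0 : x ≠ 0) :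
    ∃ α : K, A.adjugate = α • vecMulVec y x := by
  have hdet : A.det = 0 := Matrix.exists_mulVec_eq_zero_iff.1 ⟨y, hy0, hy⟩
  -- A · adj A = 0 puts every column of the adjugate in the kernel, the line through y. Below, adj A
  -- · A = 0 makes the coefficient row c a left null vector, and the same argument for Aᵀ makes it a
  -- multiple of x.
  have hcol : ∀ j, ∃ c : K, c • y = A.adjugate.col j := by
    intro j
    refine exists_smul_eq_of_adjugate_ne_zero hA hy hy0 ?_
    have := congrFun (congrArg Matrix.transpose (Matrix.mul_adjugate A)) j
    ext i
    have := congrFun this i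
    simpa [hdet, Matrix.mulVec, dotProduct, Matrix.mul_apply] using this
  choose c hc using hcol
  have hadj : A.adjugate = vecMulVec y c := by
    ext i j
    have := congrFun (hc j) i
    simp only [Pi.smul_apply, smul_eq_mul, Matrix.col_apply] at this
    rw [vecMulVec_apply, ← this, mul_comm]
  have hc0 : c ᵥ* A = 0 := by
    have h := Matrix.adjugate_mul A
    rw [hadj, hdet, zero_smul, Matrix.vecMulVec_mul] at h
    obtain ⟨i, hi⟩ := Function.ne_iff.1 hy0
    ext j
    have := congrFun (congrFun h i) j
    rw [vecMulVec_apply] at this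
    exact (mul_eq_zero.1 this).resolve_left hi
  have hAT : Aᵀ.adjugate ≠ 0 := by
    rw [← Matrix.adjugate_transpose]
    simpa using hA
  obtain ⟨α, hα⟩ := exists_smul_eq_of_adjugate_ne_zero hAT (y := x) (v := c)
    (by rwa [Matrix.mulVec_transpose]) hx0 (by rwa [Matrix.mulVec_transpose])
  exact ⟨α, by rw [hadj, ← hα, Matrix.vecMulVec_smul]⟩

end Adjugate

/-! ### Derivatives of determinants -/

section Jacobi

variable {ι 𝕜 R : Type*} [Fintype ι] [DecidableEq ι] [NontriviallyNormedField 𝕜]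
  [NormedCommRing R] [NormedAlgebra 𝕜 R]

/-- Jacobi's formula for the derivative of a determinant. -/
theorem hasDerivAt_det {N : 𝕜 → Matrix ι ι R} {N' : Matrix ι ι R} {t : 𝕜}
    (h : ∀ i j, HasDerivAt (fun t => N t i j) (N' i j) t) :
    HasDerivAt (fun t => (N t).det) ((N t).adjugate * N').trace t := by
  have h1 : HasDerivAt (fun t => (N t).det)
      (∑ σ : Equiv.Perm ι, Equiv.Perm.sign σ •
        ∑ i, (∏ j ∈ Finset.univ.erase i, N t (σ j) j) • N' (σ i) i) t := by
    simp only [Matrix.det_apply]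
    refine HasDerivAt.fun_sum fun σ _ => ?_
    have h2 := HasDerivAt.fun_finsetProd (u := Finset.univ) (fun i _ => h (σ i) i)
    have h3 := h2.const_mul (((Equiv.Perm.sign σ : ℤˣ) : ℤ) : R)
    simpa [Units.smul_def, zsmul_eq_mul] using h3
  convert h1 using 1
  -- By Cramer's rule each diagonal entry of adj(N) N' is the determinant of N with one column
  -- replaced by that of N'.
  have h4 : ((N t).adjugate * N').trace = ∑ i, ((N t).updateCol i (fun k => N' k i)).det := by
    rw [Matrix.trace]
    refine Finset.sum_congr rfl fun i _ => ?_
    rw [← Matrix.cramer_apply, Matrix.cramer_eq_adjugate_mulVec]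
    simp [Matrix.mul_apply, Matrix.mulVec, dotProduct]
  rw [h4]
  simp only [Matrix.det_apply, Finset.smul_sum]
  rw [Finset.sum_comm]
  refine Finset.sum_congr rfl fun σ _ => Finset.sum_congr rfl fun i _ => ?_
  congr 1
  rw [← Finset.mul_prod_erase _ _ (Finset.mem_univ i), Matrix.updateCol_self, smul_eq_mul,
    mul_comm]
  congr 1
  refine Finset.prod_congr rfl fun j hj => ?_
  rw [Matrix.updateCol_ne (Finset.ne_of_mem_erase hj)]

/-- The derivative of the characteristic polynomial is the trace of the adjugate. -/
theorem eval_derivative_charpoly (M : Matrix ι ι 𝕜) (z : 𝕜) :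
    M.charpoly.derivative.eval z = (scalar ι z - M).adjugate.trace := by
  have h1 := M.charpoly.hasDerivAt z
  have h2 : HasDerivAt (fun z => (scalar ι z - M).det)
      ((scalar ι z - M).adjugate * 1).trace z := by
    refine hasDerivAt_det (N := fun z => scalar ι z - M) fun i j => ?_
    rcases eq_or_ne i j with rfl | hij
    · simpa using (hasDerivAt_id z).sub_const (M i i)
    · simpa [hij] using hasDerivAt_const z (-M i j)
  rw [mul_one] at h2
  simp only [Matrix.eval_charpoly] at h1
  exact h1.unique h2

end Jacobi

end Passivation
end

noncomputable section

namespace Passivation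

/-! ### Roots of polynomials and their dependence on coefficients -/

section PolynomialRoots

open Polynomial

/-- A complex polynomial has a root near any point at which it is small compared with its
derivative. -/
theorem exists_root_norm_sub_mul_le {p : ℂ[X]} {z : ℂ} (hz : p.derivative.eval z ≠ 0) :
    ∃ r, p.eval r = 0 ∧ ‖z - r‖ * ‖p.derivative.eval z‖ ≤ p.natDegree * ‖p.eval z‖ := by
  by_cases h0 : p.eval z = 0
  · exact ⟨z, h0, by simp [h0]⟩
  have hp0 : p ≠ 0 := by rintro rfl; simp at h0
  have hsum := (IsAlgClosed.splits p).eval_derivative_div_eval_of_ne_zero h0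
  have hne : p.roots.toFinset.Nonempty := by
    rw [Finset.nonempty_iff_ne_empty, Ne, Multiset.toFinset_eq_empty]
    intro h
    rw [h] at hsum
    simp [hz, h0] at hsum
  -- In p'/p = ∑ 1/(z - s) over the roots s, the root nearest to z gives the largest term, so it
  -- bounds the whole sum.
  obtain ⟨r, hr, hmin⟩ := Finset.exists_min_image p.roots.toFinset (fun r => ‖z - r‖) hne
  have hr' : p.eval r = 0 := by
    rw [Multiset.mem_toFinset, mem_roots hp0] at hr
    exact hr
  have hpos : 0 < ‖z - r‖ := by
    rw [norm_pos_iff, sub_ne_zero]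
    rintro rfl
    exact h0 hr'
  refine ⟨r, hr', ?_⟩
  have h1 : ‖p.derivative.eval z / p.eval z‖ ≤ p.natDegree * ‖z - r‖⁻¹ := by
    rw [hsum]
    refine (norm_multiset_sum_le _).trans ?_
    refine (Multiset.sum_le_card_nsmul _ ‖z - r‖⁻¹ ?_).trans ?_
    · simp only [Multiset.map_map, Multiset.mem_map, Function.comp_apply, forall_exists_index,
        and_imp]
      rintro _ s hs rfl
      rw [one_div, norm_inv]
      exact inv_anti₀ hpos (hmin s (by simpa using hs))
    · rw [nsmul_eq_mul]
      gcongr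
      simpa using p.card_roots'
  rw [norm_div, div_le_iff₀ (norm_pos_iff.2 h0)] at h1
  calc ‖z - r‖ * ‖p.derivative.eval z‖
      ≤ ‖z - r‖ * (p.natDegree * ‖z - r‖⁻¹ * ‖p.eval z‖) := by gcongr
    _ = p.natDegree * ‖p.eval z‖ := by field_simp

/-- The derivative at one of two distinct roots, divided by the difference of the roots. -/
theorem eval_derivative_eq_sub_mul_sum {R : Type*} [CommRing R] [IsDomain R] {p : R[X]} {N : ℕ}
    (hN : p.natDegree ≤ N) {a b : R} (ha : p.eval a = 0) (hb : p.eval b = 0) (hab : a ≠ b) :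
    p.derivative.eval a =
      (a - b) * ∑ k ∈ Finset.range N, (taylor a p).coeff (k + 2) * (b - a) ^ k := by
  have h1 := taylor_eval_sub a p b
  -- Taylor expansion of p(b) = 0 at a: the constant term p(a) vanishes, and b - a can be cancelled
  -- from the rest.
  rw [hb, eval_eq_sum_range' (n := N + 2) (by rw [natDegree_taylor]; omega),
    Finset.sum_range_succ', Finset.sum_range_succ', taylor_coeff_zero, ha, zero_add,
    taylor_coeff_one, zero_mul, add_zero, pow_one] at h1
  have h2 : (b - a) * ((b - a) * ∑ k ∈ Finset.range N, (taylor a p).coeff (k + 2) * (b - a) ^ k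
      + p.derivative.eval a) = 0 := by
    rw [mul_add, mul_comm (b - a) (p.derivative.eval a), ← h1, Finset.mul_sum, Finset.mul_sum]
    congr 1
    refine Finset.sum_congr rfl fun k _ => ?_
    ring
  have h3 := (mul_eq_zero.1 h2).resolve_left (sub_ne_zero.2 hab.symm)
  linear_combination h3

theorem taylor_coeff_eq_sum {R : Type*} [CommRing R] {p : R[X]} {N : ℕ} (hN : p.natDegree ≤ N)
    (a : R) (k : ℕ) : (taylor a p).coeff k =
      ∑ i ∈ Finset.range (N + 1), ((i + k).choose k * p.coeff (i + k)) * a ^ i := by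
  rw [taylor_coeff, eval_eq_sum_range' (n := N + 1)
    (by have := natDegree_hasseDeriv_le p k; omega)]
  simp [hasseDeriv_coeff]

theorem tendsto_taylor_coeff {α R : Type*} [CommRing R] [TopologicalSpace R] [IsTopologicalRing R]
    {l : Filter α} {p : α → R[X]} {q : R[X]} {N : ℕ} (hp : ∀ t, (p t).natDegree ≤ N)
    (hq : q.natDegree ≤ N) (hpq : ∀ i, Tendsto (fun t => (p t).coeff i) l (𝓝 (q.coeff i)))
    {a : α → R} {b : R} (ha : Tendsto a l (𝓝 b)) (k : ℕ) :
    Tendsto (fun t => (taylor (a t) (p t)).coeff k) l (𝓝 ((taylor b q).coeff k)) := by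
  simp only [taylor_coeff_eq_sum hq, taylor_coeff_eq_sum (hp _)]
  exact tendsto_finsetSum _ fun i _ => ((hpq _).const_mul _).mul (ha.pow i)

/-- The root multiplicity is the order of the Taylor expansion at a. Multiplicity one yields p'(a) ≠
0; multiplicity two yields a nonzero quadratic coefficient. -/
theorem taylor_coeff_rootMultiplicity_ne_zero {R : Type*} [CommRing R] {p : R[X]} (hp : p ≠ 0)
    (a : R) : (taylor a p).coeff (p.rootMultiplicity a) ≠ 0 := by
  rw [rootMultiplicity_eq_natTrailingDegree, ← taylor_apply]
  exact trailingCoeff_nonzero_iff_nonzero.2 (by simpa using hp)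

theorem tendsto_charpoly_coeff {α ι R : Type*} [Fintype ι] [DecidableEq ι] [CommRing R]
    [TopologicalSpace R] [IsTopologicalRing R] {l : Filter α} {M : α → Matrix ι ι R}
    {Mhat : Matrix ι ι R} (h : ∀ i j, Tendsto (fun t => M t i j) l (𝓝 (Mhat i j))) (k : ℕ) :
    Tendsto (fun t => (M t).charpoly.coeff k) l (𝓝 (Mhat.charpoly.coeff k)) := by
  have key : ∀ A : Matrix ι ι R, A.charpoly.coeff k =
      MvPolynomial.eval (fun ij : ι × ι => A ij.1 ij.2) ((charpoly.univ R ι).coeff k) :=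
    fun A => (charpoly.univ_coeff_eval₂Hom ι (RingHom.id R) (fun ij => A ij.1 ij.2) k).symm
  simp only [key]
  refine ((MvPolynomial.continuous_eval _).tendsto _).comp ?_
  rw [tendsto_pi_nhds]
  exact fun ij => h ij.1 ij.2

/-- If two distinct eigenvalues coalesce to a double eigenvalue, then the derivative of the
characteristic polynomial is comparable to their distance. -/
theorem exists_tendsto_eval_derivative_charpoly {α ι : Type*} [Fintype ι] [DecidableEq ι]
    {l : Filter α} {M : α → Matrix ι ι ℂ} {Mhat : Matrix ι ι ℂ}
    (h : ∀ i j, Tendsto (fun t => M t i j) l (𝓝 (Mhat i j))) {a b : α → ℂ} {c : ℂ}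
    (ha : Tendsto a l (𝓝 c)) (hb : Tendsto b l (𝓝 c)) (hc : Mhat.charpoly.rootMultiplicity c = 2) :
    ∃ (R : α → ℂ) (Rhat : ℂ), Rhat ≠ 0 ∧ Tendsto R l (𝓝 Rhat) ∧
      ∀ t, (M t).charpoly.eval (a t) = 0 → (M t).charpoly.eval (b t) = 0 → a t ≠ b t →
        (M t).charpoly.derivative.eval (a t) = (a t - b t) * R t := by
  -- The slack of one makes the summation range a successor, so that its k = 0 term, the only one
  -- that survives in the limit, can be split off.
  have hdeg : ∀ A : Matrix ι ι ℂ, A.charpoly.natDegree ≤ Fintype.card ι + 1 := fun A => by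
    rw [Matrix.charpoly_natDegree_eq_dim]
    omega
  refine ⟨_, (taylor c Mhat.charpoly).coeff 2, ?_, ?_,
    fun t h1 h2 h3 => eval_derivative_eq_sub_mul_sum (hdeg (M t)) h1 h2 h3⟩
  · have := taylor_coeff_rootMultiplicity_ne_zero Mhat.charpoly_monic.ne_zero c
    rwa [hc] at this
  · have h1 : Tendsto (fun t => ∑ k ∈ Finset.range (Fintype.card ι + 1),
        (taylor (a t) (M t).charpoly).coeff (k + 2) * (b t - a t) ^ k) l
        (𝓝 (∑ k ∈ Finset.range (Fintype.card ι + 1),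
          (taylor c Mhat.charpoly).coeff (k + 2) * (c - c) ^ k)) :=
      tendsto_finsetSum _ fun k _ => (tendsto_taylor_coeff (fun t => hdeg _) (hdeg _)
        (fun i => tendsto_charpoly_coeff h i) ha _).mul ((hb.sub ha).pow k)
    convert h1 using 2
    rw [Finset.sum_range_succ']
    simp

end PolynomialRoots

/-! ### Perturbation of a simple eigenvalue -/

section Perturbation

variable {ι : Type*} [Fintype ι] [DecidableEq ι]

/-- A simple eigenvalue of a differentiable family of matrices extends to a family of eigenvalues
that is differentiable at the base point. -/
theorem exists_eigenvalue_hasDerivAt {N : ℝ → Matrix ι ι ℂ} {N' : Matrix ι ι ℂ} {t₀ : ℝ}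
    (hN : ∀ i j, HasDerivAt (fun t => N t i j) (N' i j) t₀) {z₀ δ : ℂ}
    (h0 : (N t₀).charpoly.eval z₀ = 0) (hs : (N t₀).charpoly.derivative.eval z₀ ≠ 0)
    (hδ : ((scalar ι z₀ - N t₀).adjugate * (scalar ι δ - N')).trace = 0) :
    ∃ μ : ℝ → ℂ, μ t₀ = z₀ ∧ (∀ t, (N t).charpoly.eval (μ t) = 0) ∧ HasDerivAt μ δ t₀ := by
  have hne : Nonempty ι := by
    by_contra h
    rw [not_nonempty_iff] at h
    simp [Matrix.charpoly] at h0
  -- The affine path z has the expected slope δ: by `hδ`, the characteristic polynomial along z is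
  -- o(t - t₀). Its derivative stays away from 0 there, so a genuine root lies within o(t - t₀) of z
  -- t.
  set z : ℝ → ℂ := fun t => z₀ + ((t - t₀ : ℝ) : ℂ) * δ with hz
  have hz0 : z t₀ = z₀ := by simp [hz]
  have hzd : HasDerivAt z δ t₀ := by
    have := (((hasDerivAt_id t₀).sub_const t₀).ofReal_comp.mul_const δ).const_add z₀
    simpa [hz] using this
  have hzN : ∀ i j, HasDerivAt (fun t => (scalar ι (z t) - N t) i j) ((scalar ι δ - N') i j) t₀ := by
    intro i j
    rcases eq_or_ne i j with rfl | hij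
    · simpa using hzd.fun_sub (hN i i)
    · simpa [hij] using (hN i j).fun_neg
  set g : ℝ → ℂ := fun t => (N t).charpoly.eval (z t) with hg
  have hgd : HasDerivAt g 0 t₀ := by
    have := hasDerivAt_det hzN
    rw [hz0, hδ] at this
    simpa only [hg, Matrix.eval_charpoly] using this
  have hg0 : g t₀ = 0 := by simp only [hg, hz0, h0]
  set d : ℝ → ℂ := fun t => (N t).charpoly.derivative.eval (z t) with hd
  have hdc : ContinuousAt d t₀ := by
    have h1 : ContinuousAt (fun t => scalar ι (z t) - N t) t₀ :=
      continuousAt_pi.2 fun i => continuousAt_pi.2 fun j => (hzN i j).continuousAt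
    have h2 : Continuous fun A : Matrix ι ι ℂ => A.adjugate.trace :=
      (continuous_id.matrix_adjugate).matrix_trace
    simp only [hd, eval_derivative_charpoly]
    exact h2.continuousAt.comp h1
  have hd0 : d t₀ ≠ 0 := by simpa only [hd, hz0] using hs
  have hroot : ∀ t, ∃ r, (N t).charpoly.eval r = 0 ∧
      (d t ≠ 0 → ‖z t - r‖ * ‖d t‖ ≤ Fintype.card ι * ‖g t‖) := by
    intro t
    by_cases h : d t = 0
    · obtain ⟨r, hr⟩ := IsAlgClosed.exists_root (N t).charpoly (by
        rw [Matrix.charpoly_degree_eq_dim]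
        exact_mod_cast Fintype.card_ne_zero)
      exact ⟨r, hr, fun h' => absurd h h'⟩
    · obtain ⟨r, hr, hr'⟩ := exists_root_norm_sub_mul_le h
      rw [Matrix.charpoly_natDegree_eq_dim] at hr'
      exact ⟨r, hr, fun _ => hr'⟩
  choose μ hμ hμ' using hroot
  have hμ0 : μ t₀ = z₀ := by
    have h1 := hμ' t₀ hd0
    rw [hg0, norm_zero, mul_zero, hz0] at h1
    have h2 : ‖z₀ - μ t₀‖ = 0 := by
      have := norm_pos_iff.2 hd0
      nlinarith [norm_nonneg (z₀ - μ t₀)]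
    exact (sub_eq_zero.1 (norm_eq_zero.1 h2)).symm
  refine ⟨μ, hμ0, hμ, ?_⟩
  have hglo : g =o[𝓝 t₀] fun t => t - t₀ := by
    simpa [hg0] using hasDerivAt_iff_isLittleO.1 hgd
  have hlo : (fun t => μ t - z t) =o[𝓝 t₀] fun t => t - t₀ := by
    refine IsBigO.trans_isLittleO ?_ hglo
    refine IsBigO.of_bound (Fintype.card ι * (‖d t₀‖ / 2)⁻¹) ?_
    have hpos : 0 < ‖d t₀‖ := norm_pos_iff.2 hd0
    have hev : ∀ᶠ t in 𝓝 t₀, ‖d t₀‖ / 2 < ‖d t‖ :=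
      hdc.norm.eventually (lt_mem_nhds (half_lt_self hpos))
    filter_upwards [hev] with t ht
    have h1 := hμ' t (norm_pos_iff.1 ((half_pos hpos).trans ht))
    rw [norm_sub_rev, mul_right_comm, ← div_eq_mul_inv, le_div_iff₀ (half_pos hpos)]
    exact (mul_le_mul_of_nonneg_left ht.le (norm_nonneg _)).trans h1
  rw [hasDerivAt_iff_isLittleO] at hzd ⊢
  refine (hlo.add hzd).congr_left fun t => ?_
  rw [hμ0, hz0]
  ring

end Perturbation

end Passivation
end

noncomputable section

namespace Passivation

/-! ### Differentiability of matrix operations -/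

section Differentiability

variable {E ι κ l : Type*} [NormedAddCommGroup E] [NormedSpace ℝ E]

theorem differentiableAt_matrix [Fintype κ] {A : E → Matrix ι κ ℝ} {x : E} :
    DifferentiableAt ℝ A x ↔ ∀ i j, DifferentiableAt ℝ (fun x => A x i j) x :=
  (differentiableAt_pi (Φ := fun x i => A x i)).trans (forall_congr' fun _ => differentiableAt_pi)

theorem hasDerivAt_matrix [Fintype κ] {A : ℝ → Matrix ι κ ℝ} {A' : Matrix ι κ ℝ} {t : ℝ} :
    HasDerivAt A A' t ↔ ∀ i j, HasDerivAt (fun t => A t i j) (A' i j) t :=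
  (hasDerivAt_pi (φ := fun t i => A t i)).trans (forall_congr' fun _ => hasDerivAt_pi)

theorem differentiableAt_matrix_mul [Fintype κ] [Fintype l] {A : E → Matrix ι κ ℝ} {B : E → Matrix κ l ℝ} {x : E}
    (hA : DifferentiableAt ℝ A x) (hB : DifferentiableAt ℝ B x) :
    DifferentiableAt ℝ (fun x => A x * B x) x := by
  rw [differentiableAt_matrix] at hA hB ⊢
  intro i j
  simp only [Matrix.mul_apply]
  exact DifferentiableAt.fun_sum fun k _ => (hA i k).mul (hB k j)

theorem differentiableAt_matrix_transpose [Fintype ι] [Fintype κ] {A : E → Matrix ι κ ℝ} {x : E}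
    (hA : DifferentiableAt ℝ A x) : DifferentiableAt ℝ (fun x => (A x)ᵀ) x :=
  differentiableAt_matrix.2 fun i j => differentiableAt_matrix.1 hA j i

theorem differentiableAt_fromRows [Fintype l] {A : E → Matrix ι l ℝ} {B : E → Matrix κ l ℝ} {x : E}
    (hA : DifferentiableAt ℝ A x) (hB : DifferentiableAt ℝ B x) :
    DifferentiableAt ℝ (fun x => fromRows (A x) (B x)) x := by
  rw [differentiableAt_matrix] at hA hB ⊢
  rintro (i | i) j
  · exact hA i j
  · exact hB i j

theorem differentiableAt_fromBlocks {κ' : Type*} [Fintype l] [Fintype κ'] {A : E → Matrix ι l ℝ}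
    {B : E → Matrix ι κ' ℝ} {C : E → Matrix κ l ℝ} {D : E → Matrix κ κ' ℝ} {x : E}
    (hA : DifferentiableAt ℝ A x) (hB : DifferentiableAt ℝ B x) (hC : DifferentiableAt ℝ C x)
    (hD : DifferentiableAt ℝ D x) :
    DifferentiableAt ℝ (fun x => fromBlocks (A x) (B x) (C x) (D x)) x := by
  rw [differentiableAt_matrix] at hA hB hC hD ⊢
  rintro (i | i) (j | j)
  · exact hA i j
  · exact hB i j
  · exact hC i j
  · exact hD i j

section Inverse

attribute [local instance] Matrix.frobeniusNormedRing Matrix.frobeniusNormedAlgebra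

theorem differentiableAt_matrix_inv [Fintype ι] [DecidableEq ι] {A : E → Matrix ι ι ℝ} {x : E}
    (hA : DifferentiableAt ℝ A x) (hu : IsUnit (A x)) :
    DifferentiableAt ℝ (fun x => (A x)⁻¹) x := by
  simp only [Matrix.nonsing_inv_eq_ringInverse]
  have : CompleteSpace (Matrix ι ι ℝ) := FiniteDimensional.complete ℝ _
  exact (differentiableAt_inverse hu).comp x hA

end Inverse

end Differentiability

/-! ### Smooth dependence and symmetry of the Hamiltonian matrix -/

section Hamiltonian

variable {n p m : ℕ}

theorem differentiableAt_toBlocks (X : SystemMatrix n p m) :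
    DifferentiableAt ℝ (fun X : SystemMatrix n p m => X.toBlocks₁₁) X ∧
    DifferentiableAt ℝ (fun X : SystemMatrix n p m => X.toBlocks₁₂) X ∧
    DifferentiableAt ℝ (fun X : SystemMatrix n p m => X.toBlocks₂₁) X ∧
    DifferentiableAt ℝ (fun X : SystemMatrix n p m => X.toBlocks₂₂) X := by
  have h := differentiableAt_matrix.1 (differentiableAt_fun_id (𝕜 := ℝ) (x := X))
  exact ⟨differentiableAt_matrix.2 fun i j => h _ _, differentiableAt_matrix.2 fun i j => h _ _,
    differentiableAt_matrix.2 fun i j => h _ _, differentiableAt_matrix.2 fun i j => h _ _⟩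

/-- The Hamiltonian matrix depends differentiably on admissible systems. -/
theorem PassivityNotion.differentiableAt_hamiltonian (ν : PassivityNotion p m)
    {X : SystemMatrix n p m} (hX : ν.Admissible X) : DifferentiableAt ℝ (ν.hamiltonian (n := n)) X := by
  cases ν with
  | immittance =>
    obtain ⟨hA, hB, hC, hD⟩ := differentiableAt_toBlocks X
    have hAT := differentiableAt_matrix_transpose hA
    have hCT := differentiableAt_matrix_transpose hC
    have hDT := differentiableAt_matrix_transpose hD
    have h0 := differentiableAt_const (𝕜 := ℝ) (x := X) (0 : Matrix (Fin n) (Fin n) ℝ)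
    have hu : IsUnit (X.toBlocks₂₂ + X.toBlocks₂₂ᵀ) := Matrix.PosDef.isUnit hX
    exact (differentiableAt_fromBlocks hA h0 h0 hAT.fun_neg).fun_sub
      (differentiableAt_matrix_mul (differentiableAt_matrix_mul
        (differentiableAt_fromRows hB hCT.fun_neg)
          (differentiableAt_matrix_inv (hD.fun_add hDT) hu))
        (differentiableAt_matrix_transpose (differentiableAt_fromRows hCT hB)))
  | scattering =>
    obtain ⟨hA, hB, hC, hD⟩ := differentiableAt_toBlocks X
    have hAT := differentiableAt_matrix_transpose hA
    have hCT := differentiableAt_matrix_transpose hC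
    have hDT := differentiableAt_matrix_transpose hD
    have h0 := differentiableAt_const (𝕜 := ℝ) (x := X) (0 : Matrix (Fin n) (Fin n) ℝ)
    have h1 := differentiableAt_const (𝕜 := ℝ) (x := X) (1 : Matrix (Fin m) (Fin m) ℝ)
    have hu : IsUnit (1 - X.toBlocks₂₂ᵀ * X.toBlocks₂₂) := Matrix.PosDef.isUnit hX
    have hCD := differentiableAt_matrix_mul hCT hD
    exact (differentiableAt_fromBlocks hA h0 (differentiableAt_matrix_mul hCT hC).fun_neg
        hAT.fun_neg).fun_add
      (differentiableAt_matrix_mul (differentiableAt_matrix_mul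
        (differentiableAt_fromRows hB hCD.fun_neg)
          (differentiableAt_matrix_inv (h1.fun_sub (differentiableAt_matrix_mul hDT hD)) hu))
        (differentiableAt_matrix_transpose (differentiableAt_fromRows hCD hB)))

/-- `M(X)` has the block structure of a Hamiltonian matrix. -/
theorem PassivityNotion.exists_hamiltonian_eq_fromBlocks (ν : PassivityNotion p m)
    (X : SystemMatrix n p m) : ∃ a b c : Matrix (Fin n) (Fin n) ℝ, bᵀ = b ∧ cᵀ = c ∧
      ν.hamiltonian X = fromBlocks a b c (-aᵀ) := by
  cases ν with
  | immittance =>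
    set R := (X.toBlocks₂₂ + X.toBlocks₂₂ᵀ)⁻¹ with hR
    have hRT : Rᵀ = R := by
      rw [hR, Matrix.transpose_nonsing_inv, Matrix.transpose_add, Matrix.transpose_transpose,
        add_comm]
    refine ⟨X.toBlocks₁₁ - X.toBlocks₁₂ * R * X.toBlocks₂₁, -(X.toBlocks₁₂ * R * X.toBlocks₁₂ᵀ),
      X.toBlocks₂₁ᵀ * R * X.toBlocks₂₁, ?_, ?_, ?_⟩
    · simp [Matrix.transpose_mul, hRT, Matrix.mul_assoc]
    · simp [Matrix.transpose_mul, hRT, Matrix.mul_assoc]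
    · rw [PassivityNotion.hamiltonian, immittanceHamiltonian, ← hR, Matrix.transpose_fromRows,
        Matrix.fromRows_mul, Matrix.fromRows_mul_fromCols]
      simp [Matrix.fromBlocks_add, Matrix.fromBlocks_neg, hRT, Matrix.mul_assoc, sub_eq_add_neg]
      exact add_comm _ _
  | scattering =>
    set R := (1 - X.toBlocks₂₂ᵀ * X.toBlocks₂₂)⁻¹ with hR
    have hRT : Rᵀ = R := by
      rw [hR, Matrix.transpose_nonsing_inv, Matrix.transpose_sub, Matrix.transpose_mul,
        Matrix.transpose_transpose, Matrix.transpose_one]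
    refine ⟨X.toBlocks₁₁ + X.toBlocks₁₂ * R * (X.toBlocks₂₂ᵀ * X.toBlocks₂₁),
      X.toBlocks₁₂ * R * X.toBlocks₁₂ᵀ, -(X.toBlocks₂₁ᵀ * X.toBlocks₂₁) -
        X.toBlocks₂₁ᵀ * X.toBlocks₂₂ * R * (X.toBlocks₂₂ᵀ * X.toBlocks₂₁), ?_, ?_, ?_⟩
    · simp [Matrix.transpose_mul, hRT, Matrix.mul_assoc]
    · simp [Matrix.transpose_mul, hRT, Matrix.mul_assoc]
    · rw [PassivityNotion.hamiltonian, scatteringHamiltonian, ← hR, Matrix.transpose_fromRows,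
        Matrix.fromRows_mul, Matrix.fromRows_mul_fromCols]
      simp [Matrix.fromBlocks_add, Matrix.transpose_mul, hRT, Matrix.mul_assoc, sub_eq_add_neg]
      abel

/-- The spectrum of a real Hamiltonian matrix is symmetric about the imaginary axis. -/
theorem eval_charpoly_neg_conj_eq_zero {a b c : Matrix (Fin n) (Fin n) ℝ} (hb : bᵀ = b)
    (hc : cᵀ = c) {z : ℂ} (hz : (toComplex (fromBlocks a b c (-aᵀ))).charpoly.eval z = 0) :
    (toComplex (fromBlocks a b c (-aᵀ))).charpoly.eval (-(starRingEnd ℂ z)) = 0 := by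
  set M := fromBlocks a b c (-aᵀ) with hM
  -- Two symmetries are combined: J gives the spectrum invariance under z ↦ -z, and real entries
  -- give invariance under conjugation.
  have hJM : J (Fin n) ℝ * M = -(Mᵀ * J (Fin n) ℝ) := by
    simp [hM, J, Matrix.fromBlocks_multiply, Matrix.fromBlocks_transpose, Matrix.fromBlocks_neg,
      hb, hc]
  have hJM' : J (Fin n) ℂ * toComplex M = -((toComplex M)ᵀ * J (Fin n) ℂ) := by
    have h1 := congrArg (fun A : StateMatrix n => A.map Complex.ofRealHom) hJM
    have h2 : (J (Fin n) ℝ).map Complex.ofRealHom = J (Fin n) ℂ := by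
      ext (i | i) (j | j) <;> simp [J, Matrix.one_apply, apply_ite]
    simp only [Matrix.map_mul, Matrix.map_neg _ (map_neg Complex.ofRealHom), h2] at h1
    exact h1
  have hconj : (toComplex M).charpoly.eval (starRingEnd ℂ z) = 0 := by
    have h1 : (toComplex M).charpoly = M.charpoly.map Complex.ofRealHom :=
      Matrix.charpoly_map M Complex.ofRealHom
    rw [h1, Polynomial.eval_map] at hz ⊢
    have h2 := congrArg (starRingEnd ℂ) hz
    rw [Polynomial.hom_eval₂, map_zero] at h2
    rw [← h2]
    congr 1
    ext r
    simp
  set w := starRingEnd ℂ z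
  rw [Matrix.eval_charpoly] at hconj ⊢
  have h3 : J (Fin n) ℂ * (scalar _ (-w) - toComplex M) =
      -((scalar _ w - toComplex M)ᵀ * J (Fin n) ℂ) := by
    rw [Matrix.mul_sub, hJM', Matrix.transpose_sub, Matrix.sub_mul]
    have : J (Fin n) ℂ * scalar _ (-w) = -((scalar (Fin n ⊕ Fin n) w)ᵀ * J (Fin n) ℂ) := by
      ext i j
      simp [Matrix.mul_diagonal, Matrix.diagonal_mul, mul_comm]
    rw [this]
    abel
  have h4 := congrArg Matrix.det h3
  rw [Matrix.det_neg, Matrix.det_mul, Matrix.det_mul, Matrix.det_transpose, hconj, zero_mul,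
    mul_zero] at h4
  exact (mul_eq_zero.1 h4).resolve_left (Matrix.isUnit_det_J (Fin n) ℂ).ne_zero

end Hamiltonian

end Passivation
end

noncomputable section

namespace Passivation

/-! ### Geometry of the Frobenius unit sphere -/

section FrobeniusInner

variable {ι κ : Type*} [Fintype ι] [Fintype κ]

theorem norm_sq_eq_frobInner (U : Matrix ι κ ℝ) : ‖U‖ ^ 2 = frobInner U U := by
  rw [Matrix.frobenius_norm_def, ← Real.sqrt_eq_rpow, Real.sq_sqrt (by positivity),
    frobInner_eq_sum]
  simp [sq]

theorem frobInner_comm (U V : Matrix ι κ ℝ) : frobInner U V = frobInner V U := by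
  simp only [frobInner_eq_sum, mul_comm]

theorem frobInner_add_left (U V W : Matrix ι κ ℝ) :
    frobInner (U + V) W = frobInner U W + frobInner V W := by
  simp [frobInner, Matrix.add_mul]

theorem frobInner_smul_left (c : ℝ) (U W : Matrix ι κ ℝ) :
    frobInner (c • U) W = c * frobInner U W := by
  simp [frobInner]

theorem frobInner_add_right (U V W : Matrix ι κ ℝ) :
    frobInner U (V + W) = frobInner U V + frobInner U W := by
  rw [frobInner_comm, frobInner_add_left, frobInner_comm V, frobInner_comm W]

theorem frobInner_smul_right (c : ℝ) (U W : Matrix ι κ ℝ) :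
    frobInner U (c • W) = c * frobInner U W := by
  rw [frobInner_comm, frobInner_smul_left, frobInner_comm W]

theorem hasDerivAt_frobInner_self {U : ℝ → Matrix ι κ ℝ} {U' : Matrix ι κ ℝ} {t : ℝ}
    (hU : HasDerivAt U U' t) :
    HasDerivAt (fun t => frobInner (U t) (U t)) (2 * frobInner (U t) U') t := by
  simp only [frobInner_eq_sum, Finset.mul_sum]
  rw [hasDerivAt_matrix] at hU
  refine HasDerivAt.fun_sum fun i _ => HasDerivAt.fun_sum fun j _ => ?_
  rw [show 2 * (U t i j * U' i j) = U' i j * U t i j + U t i j * U' i j by ring]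
  exact (hU i j).fun_mul (hU i j)

/-- A vector whose orthogonal complement contains that of a unit vector `E` is `±` its norm times
`E`. -/
theorem sq_frobInner_eq_norm_sq {E G : Matrix ι κ ℝ} (hE : ‖E‖ = 1)
    (h : ∀ V, frobInner E V = 0 → frobInner V G = 0) : frobInner E G ^ 2 = ‖G‖ ^ 2 := by
  have hEE : frobInner E E = 1 := by rw [← norm_sq_eq_frobInner, hE, one_pow]
  -- The test vector is the tangential component of G.
  have h1 := h (G + (-frobInner E G) • E) (by
    rw [frobInner_add_right, frobInner_smul_right, hEE]
    ring)
  rw [frobInner_add_left, frobInner_smul_left] at h1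
  rw [norm_sq_eq_frobInner]
  linarith

/-- A curve on the Frobenius unit sphere with prescribed tangent. -/
theorem exists_hasDerivAt_sphere {E V : Matrix ι κ ℝ} (hE : ‖E‖ = 1) (hV : frobInner E V = 0) :
    ∃ c : ℝ → Matrix ι κ ℝ, c 0 = E ∧ (∀ t, ‖c t‖ = 1) ∧ HasDerivAt c V 0 := by
  have hq : ∀ t : ℝ, 0 < 1 + t ^ 2 * ‖V‖ ^ 2 := fun t => by positivity
  -- Orthogonality gives ‖E + tV‖² = 1 + t²‖V‖², so the normalizing factor has zero derivative at 0.
  refine ⟨fun t => (√(1 + t ^ 2 * ‖V‖ ^ 2))⁻¹ • (E + t • V), by simp, fun t => ?_, ?_⟩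
  · have h1 : ‖E + t • V‖ ^ 2 = 1 + t ^ 2 * ‖V‖ ^ 2 := by
      rw [norm_sq_eq_frobInner, frobInner_add_left, frobInner_add_right, frobInner_add_right,
        frobInner_smul_left, frobInner_smul_left, frobInner_smul_right, frobInner_smul_right,
        frobInner_comm V E, hV, ← norm_sq_eq_frobInner, ← norm_sq_eq_frobInner, hE]
      ring
    rw [norm_smul, ← h1, Real.sqrt_sq (norm_nonneg _), norm_inv, norm_norm]
    refine inv_mul_cancel₀ fun h0 => ?_
    rw [h0] at h1
    linarith [hq t]
  · have h1 : HasDerivAt (fun t : ℝ => 1 + t ^ 2 * ‖V‖ ^ 2) 0 0 := by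
      simpa using (((hasDerivAt_id (0 : ℝ)).pow 2).mul_const (‖V‖ ^ 2)).const_add 1
    have h2 : HasDerivAt (fun t : ℝ => (√(1 + t ^ 2 * ‖V‖ ^ 2))⁻¹) 0 0 := by
      have h3 := (h1.sqrt (hq 0).ne').fun_inv (Real.sqrt_pos.2 (hq 0)).ne'
      simpa using h3
    rw [hasDerivAt_matrix]
    intro i j
    have h4 : HasDerivAt (fun t : ℝ => E i j + t * V i j) (V i j) 0 := by
      simpa using ((hasDerivAt_id (0 : ℝ)).mul_const (V i j)).const_add (E i j)
    simpa using h2.fun_mul h4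

end FrobeniusInner

/-! ### Eigenvalue derivatives and the gradient -/

section Eigenpair

variable {n p m k l : ℕ} {M : StateMatrix n} {z : ℂ} {x y : Fin n ⊕ Fin n → ℂ}

theorem norm_vecMulVec {ι κ : Type*} [Fintype ι] [Fintype κ] (u : ι → ℂ) (v : κ → ℂ) :
    ‖vecMulVec u v‖ = ‖WithLp.toLp 2 u‖ * ‖WithLp.toLp 2 v‖ := by
  rw [Matrix.frobenius_norm_def, EuclideanSpace.norm_eq, EuclideanSpace.norm_eq,
    ← Real.sqrt_mul (by positivity), ← Real.sqrt_eq_rpow, Finset.sum_mul_sum]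
  simp [vecMulVec_apply, mul_pow]

theorem trace_vecMulVec_mul {ι R : Type*} [Fintype ι] [CommRing R] (u v : ι → R)
    (B : Matrix ι ι R) : (vecMulVec u v * B).trace = v ⬝ᵥ (B *ᵥ u) := by
  rw [Matrix.vecMulVec_mul, Matrix.trace_vecMulVec, dotProduct_comm, Matrix.dotProduct_mulVec]

/-- A simple eigenvalue: the adjugate is a multiple of the spectral projection. -/
theorem IsNormalizedEigenpair.exists_adjugate_eq (h : IsNormalizedEigenpair M z x y)
    (hz : (toComplex M).charpoly.rootMultiplicity z = 1) :
    (toComplex M).charpoly.derivative.eval z ≠ 0 ∧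
    ∃ α : ℂ, (scalar _ z - toComplex M).adjugate = α • vecMulVec y (star x) ∧
      α * (star x ⬝ᵥ y) = (toComplex M).charpoly.derivative.eval z ∧
      ‖(scalar _ z - toComplex M).adjugate‖ = ‖α‖ := by
  have hd : (toComplex M).charpoly.derivative.eval z ≠ 0 := by
    have := taylor_coeff_rootMultiplicity_ne_zero (toComplex M).charpoly_monic.ne_zero z
    rwa [hz, Polynomial.taylor_coeff_one] at this
  refine ⟨hd, ?_⟩
  have hadj : (scalar _ z - toComplex M).adjugate ≠ 0 := by
    intro h0
    rw [eval_derivative_charpoly, h0, Matrix.trace_zero] at hd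
    exact hd rfl
  have hscal : ∀ v : Fin n ⊕ Fin n → ℂ, (scalar _ z) *ᵥ v = z • v := fun v => by
    ext i
    simp [Matrix.mulVec_diagonal]
  have hscal' : ∀ v : Fin n ⊕ Fin n → ℂ, v ᵥ* (scalar _ z) = z • v := fun v => by
    ext i
    simp [Matrix.vecMul_diagonal, mul_comm]
  obtain ⟨α, hα⟩ := exists_adjugate_eq_smul_vecMulVec hadj (x := star x) (y := y)
    (by rw [Matrix.sub_mulVec, hscal, h.right, sub_self])
    (by rintro rfl; simpa using h.norm_right)
    (by rw [Matrix.vecMul_sub, hscal', h.left, sub_self])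
    (by
      intro h0
      have : x = 0 := by simpa using h0
      have h1 := h.norm_left
      simp [this] at h1)
  refine ⟨α, hα, ?_, ?_⟩
  · rw [eval_derivative_charpoly, hα, Matrix.trace_smul, Matrix.trace_vecMulVec, dotProduct_comm,
      smul_eq_mul]
  · have hsx : ‖WithLp.toLp 2 (star x)‖ = 1 := by
      rw [← h.norm_left, EuclideanSpace.norm_eq, EuclideanSpace.norm_eq]
      simp
    have hn : ‖α • vecMulVec y (star x)‖ = ‖α‖ * ‖vecMulVec y (star x)‖ := norm_smul _ _
    rw [hα, hn, norm_vecMulVec, h.norm_right, hsx, mul_one, mul_one]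

theorem re_dotProduct_mulVec_eq_frobInner (N : StateMatrix n) (x y : Fin n ⊕ Fin n → ℂ) :
    (star x ⬝ᵥ (toComplex N *ᵥ y)).re = frobInner N ((vecMulVec x (star y)).map Complex.re) := by
  simp only [dotProduct, Matrix.mulVec, frobInner_eq_sum, Complex.re_sum, Finset.mul_sum]
  refine Finset.sum_congr rfl fun i _ => Finset.sum_congr rfl fun j _ => ?_
  simp [vecMulVec_apply]
  ring

/-- Moving both adjoints back shows that `freeGradient` represents the functional V ↦ Re(x* M'[L V]
y), which is x*y times the first-order change of Re λ. -/
theorem frobInner_freeGradient (ν : PassivityNotion p m) (X : SystemMatrix n p m)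
    (L : Matrix (Fin k) (Fin l) ℝ →ₗ[ℝ] SystemMatrix n p m) (ε : ℝ)
    (E V : Matrix (Fin k) (Fin l) ℝ) (x y : Fin n ⊕ Fin n → ℂ) :
    (star x ⬝ᵥ (toComplex (fderiv ℝ ν.hamiltonian (X + L (ε • E)) (L V)) *ᵥ y)).re =
      frobInner V (freeGradient ν X L ε E x y) := by
  rw [re_dotProduct_mulVec_eq_frobInner, freeGradient, ← frobInner_frobAdjoint,
    ← frobInner_frobAdjoint]
  rfl

/-- The chain rule for `M(X + L[W])` along a path `W`. -/
theorem hasDerivAt_hamiltonian (ν : PassivityNotion p m) (X : SystemMatrix n p m)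
    (L : Matrix (Fin k) (Fin l) ℝ →ₗ[ℝ] SystemMatrix n p m) {W : ℝ → Matrix (Fin k) (Fin l) ℝ}
    {W' : Matrix (Fin k) (Fin l) ℝ} {t : ℝ} (hW : HasDerivAt W W' t)
    (hadm : ν.Admissible (X + L (W t))) (i j : Fin n ⊕ Fin n) :
    HasDerivAt (fun t => toComplex (ν.hamiltonian (X + L (W t))) i j)
      (toComplex (fderiv ℝ ν.hamiltonian (X + L (W t)) (L W')) i j) t := by
  have hL : HasDerivAt (fun t => X + L (W t)) (L W') t :=
    (L.toContinuousLinearMap.hasFDerivAt.comp_hasDerivAt t hW).const_add X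
  have h := (ν.differentiableAt_hamiltonian hadm).hasFDerivAt.comp_hasDerivAt t hL
  exact (hasDerivAt_matrix.1 h i j).ofReal_comp

theorem IsNormalizedEigenpair.dotProduct_eq (h : IsNormalizedEigenpair M z x y) :
    star x ⬝ᵥ y = ((star x ⬝ᵥ y).re : ℂ) :=
  Complex.ext rfl (by simpa using h.im_eq_zero)

/-- This is Jacobi's formula for det(λ - M) with a rank-one adjugate. For α ≠ 0 it vanishes exactly
when δ x*y = x*Ny, the first-order formula for an eigenvalue. -/
theorem trace_smul_vecMulVec_mul_scalar_sub (α δ : ℂ) (x y : Fin n ⊕ Fin n → ℂ)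
    (N : StateMatrix n) :
    (α • vecMulVec y (star x) * (scalar _ δ - toComplex N)).trace =
      α * (δ * (star x ⬝ᵥ y) - star x ⬝ᵥ (toComplex N *ᵥ y)) := by
  have hscal : (scalar (Fin n ⊕ Fin n) δ) *ᵥ y = δ • y := by
    ext i
    simp [Matrix.mulVec_diagonal]
  rw [Matrix.smul_mul, Matrix.trace_smul, trace_vecMulVec_mul, Matrix.sub_mulVec, hscal,
    dotProduct_sub, dotProduct_smul, smul_eq_mul, smul_eq_mul]

theorem minRealPart_le {μ : ℂ} (hμ : (toComplex M).charpoly.eval μ = 0) (h0 : 0 ≤ μ.re) :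
    minRealPart M ≤ μ.re :=
  csInf_le ⟨0, by rintro _ ⟨w, hw, rfl⟩; exact hw.2⟩
    ⟨μ, ⟨Matrix.mem_spectrum_iff_isRoot_charpoly.2 hμ, h0⟩, rfl⟩

/-- At a local minimizer of `φ_ε` on the sphere, the gradient vanishes in tangential
directions. -/
theorem frobInner_freeGradient_eq_zero (ν : PassivityNotion p m) (X : SystemMatrix n p m)
    (L : Matrix (Fin k) (Fin l) ℝ →ₗ[ℝ] SystemMatrix n p m) {ε : ℝ} (hε : 0 < ε)
    {E V : Matrix (Fin k) (Fin l) ℝ} (hadm : ν.Admissible (X + L (ε • E))) (hE : ‖E‖ = 1)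
    (hmin : IsLocalMinOn (phi ν X L ε) {F | ‖F‖ = 1} E)
    (hz : IsLeadingEigenvalue (ν.hamiltonian (X + L (ε • E))) z) (hpos : 0 < z.re)
    (hxy : IsNormalizedEigenpair (ν.hamiltonian (X + L (ε • E))) z x y)
    (hsimple : (toComplex (ν.hamiltonian (X + L (ε • E)))).charpoly.rootMultiplicity z = 1)
    (hV : frobInner E V = 0) : frobInner V (freeGradient ν X L ε E x y) = 0 := by
  obtain ⟨c, hc0, hc1, hcd⟩ := exists_hasDerivAt_sphere hE hV
  obtain ⟨hd, α, hα, -, -⟩ := hxy.exists_adjugate_eq hsimple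
  have hκ := hxy.dotProduct_eq
  have hκ0 := hxy.re_pos
  set κ := (star x ⬝ᵥ y).re
  have hN := hasDerivAt_hamiltonian ν X L (W := fun t => ε • c t) (hcd.const_smul ε)
    (by simpa only [hc0] using hadm)
  simp only [hc0] at hN
  set N' := fderiv ℝ ν.hamiltonian (X + L (ε • E)) (L (ε • V)) with hN'
  obtain ⟨μ, hμ0, hμ, hμd⟩ := exists_eigenvalue_hasDerivAt
    (N := fun t => toComplex (ν.hamiltonian (X + L (ε • c t)))) (N' := toComplex N')
    (z₀ := z) (δ := (star x ⬝ᵥ (toComplex N' *ᵥ y)) / κ) hN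
    (by rw [hc0]; exact Matrix.mem_spectrum_iff_isRoot_charpoly.1 hz.1)
    (by rw [hc0]; exact hd)
    (by
      rw [hc0, hα, trace_smul_vecMulVec_mul_scalar_sub, hκ, div_mul_cancel₀, sub_self, mul_zero]
      exact_mod_cast hκ0.ne')
  have hre : HasDerivAt (fun t => (μ t).re) ((star x ⬝ᵥ (toComplex N' *ᵥ y)) / κ).re 0 :=
    Complex.reCLM.hasFDerivAt.comp_hasDerivAt 0 hμd
  -- The branch μ need not be leading for t ≠ 0: it suffices that its real part, positive near 0,
  -- dominates φ, with equality at t = 0.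
  have hlm : IsLocalMin (fun t => (μ t).re) 0 := by
    have h1 : ∀ᶠ t in 𝓝 (0 : ℝ), 0 < (μ t).re :=
      hre.continuousAt.eventually (lt_mem_nhds (by simpa only [hμ0] using hpos))
    have h2 : Tendsto c (𝓝 0) (𝓝[{F | ‖F‖ = 1}] E) := by
      refine tendsto_nhdsWithin_iff.2 ⟨?_, Eventually.of_forall hc1⟩
      rw [← hc0]
      exact hcd.continuousAt
    filter_upwards [h1, h2.eventually hmin] with t ht1 ht2
    calc (μ 0).re = phi ν X L ε E := by rw [hμ0, phi, hz.minRealPart_eq]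
      _ ≤ phi ν X L ε (c t) := ht2
      _ ≤ (μ t).re := minRealPart_le (hμ t) ht1.le
  have h3 := hlm.hasDerivAt_eq_zero hre
  rw [Complex.div_ofReal_re, div_eq_zero_iff] at h3
  have h4 := h3.resolve_right hκ0.ne'
  rw [hN', frobInner_freeGradient, frobInner_smul_left] at h4
  exact (mul_eq_zero.1 h4).resolve_left hε.ne'

/-- The derivative of a simple eigenvalue along a path of perturbations. -/
theorem re_mul_eq_frobInner_freeGradient (ν : PassivityNotion p m) (X : SystemMatrix n p m)
    (L : Matrix (Fin k) (Fin l) ℝ →ₗ[ℝ] SystemMatrix n p m) {ε : ℝ}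
    {E : ℝ → Matrix (Fin k) (Fin l) ℝ} {E' : Matrix (Fin k) (Fin l) ℝ} (hE : HasDerivAt E E' ε)
    {lam : ℝ → ℂ} {lam' : ℂ} (hlam : HasDerivAt lam lam' ε)
    (hadm : ν.Admissible (X + L (ε • E ε)))
    (heig : ∀ᶠ t in 𝓝 ε, (toComplex (ν.hamiltonian (X + L (t • E t)))).charpoly.eval (lam t) = 0)
    (hxy : IsNormalizedEigenpair (ν.hamiltonian (X + L (ε • E ε))) (lam ε) x y)
    (hsimple :
      (toComplex (ν.hamiltonian (X + L (ε • E ε)))).charpoly.rootMultiplicity (lam ε) = 1) :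
    lam'.re * (star x ⬝ᵥ y).re =
      frobInner (E ε + ε • E') (freeGradient ν X L ε (E ε) x y) := by
  obtain ⟨hd, α, hα, hακ, -⟩ := hxy.exists_adjugate_eq hsimple
  have hα0 : α ≠ 0 := by
    rintro rfl
    rw [zero_mul] at hακ
    exact hd hακ.symm
  have hW : HasDerivAt (fun t => t • E t) (E ε + ε • E') ε := by
    rw [hasDerivAt_matrix] at hE ⊢
    intro i j
    simpa using (hasDerivAt_id ε).fun_mul (hE i j)
  have hN := hasDerivAt_hamiltonian ν X L hW hadm
  set N' := fderiv ℝ ν.hamiltonian (X + L (ε • E ε)) (L (E ε + ε • E')) with hN'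
  have hdet : HasDerivAt
      (fun t => (scalar _ (lam t) - toComplex (ν.hamiltonian (X + L (t • E t)))).det)
      ((scalar _ (lam ε) - toComplex (ν.hamiltonian (X + L (ε • E ε)))).adjugate *
        (scalar _ lam' - toComplex N')).trace ε := by
    refine hasDerivAt_det
      (N := fun t => scalar _ (lam t) - toComplex (ν.hamiltonian (X + L (t • E t)))) fun i j => ?_
    rcases eq_or_ne i j with rfl | hij
    · simpa using hlam.fun_sub (hN i i)
    · simpa [hij] using (hN i j).fun_neg
  -- The determinant vanishes identically near ε, so its Jacobi derivative is 0; dividing by α gives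
  -- the derivative of λ.
  have hzero : HasDerivAt
      (fun t => (scalar _ (lam t) - toComplex (ν.hamiltonian (X + L (t • E t)))).det) 0 ε := by
    refine (hasDerivAt_const ε (0 : ℂ)).congr_of_eventuallyEq ?_
    filter_upwards [heig] with t ht
    rwa [Matrix.eval_charpoly] at ht
  have h1 := hdet.unique hzero
  rw [hα, trace_smul_vecMulVec_mul_scalar_sub] at h1
  have h2 := sub_eq_zero.1 ((mul_eq_zero.1 h1).resolve_left hα0)
  rw [← frobInner_freeGradient, ← hN', ← h2, hxy.dotProduct_eq, Complex.re_mul_ofReal,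
    Complex.ofReal_re]

end Eigenpair

end Passivation
end

noncomputable section

namespace Passivation

/-! ### Square root asymptotics from a differential relation -/

section SquareRoot

/-- A positive function whose derivative never vanishes and that tends to zero at the right
endpoint has a negative derivative. -/
theorem deriv_neg_of_tendsto_zero {f f' : ℝ → ℝ} {a b : ℝ} (hab : a < b)
    (hf : ∀ t ∈ Ioo a b, HasDerivAt f (f' t) t) (hpos : ∀ t ∈ Ioo a b, 0 < f t)
    (hne : ∀ t ∈ Ioo a b, f' t ≠ 0) (hlim : Tendsto f (𝓝[<] b) (𝓝 0)) :
    ∀ t ∈ Ioo a b, f' t < 0 := by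
  -- By Darboux's theorem the derivative has constant sign; a positive sign would keep f above a
  -- positive value.
  rcases hasDerivWithinAt_forall_lt_or_forall_gt_of_forall_ne (convex_Ioo a b)
    (fun t ht => (hf t ht).hasDerivWithinAt) hne with h | h
  · exact h
  · exfalso
    have hmono : StrictMonoOn f (Ioo a b) := by
      refine strictMonoOn_of_deriv_pos (convex_Ioo a b)
        (fun t ht => (hf t ht).continuousAt.continuousWithinAt) fun t ht => ?_
      rw [interior_Ioo] at ht
      rw [(hf t ht).deriv]
      exact h t ht
    obtain ⟨t₀, ht₀⟩ := nonempty_Ioo.2 hab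
    have hge : ∀ᶠ t in 𝓝[<] b, f t₀ ≤ f t := by
      filter_upwards [Ioo_mem_nhdsLT ht₀.2] with t ht
      exact (hmono ht₀ ⟨ht₀.1.trans ht.1, ht.2⟩ ht.1).le
    exact absurd (ge_of_tendsto hlim hge) (not_le.2 (hpos t₀ ht₀))

/-- A positive solution of `f f' → -c` that vanishes at the right endpoint has a square root
singularity there. -/
theorem isEquivalent_sqrt {f f' : ℝ → ℝ} {a b c : ℝ} (hab : a < b) (hc : 0 < c)
    (hf : ∀ t ∈ Ioo a b, HasDerivAt f (f' t) t) (hpos : ∀ t ∈ Ioo a b, 0 < f t)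
    (hlim : Tendsto f (𝓝[<] b) (𝓝 0)) (h : Tendsto (fun t => f t * f' t) (𝓝[<] b) (𝓝 (-c))) :
    f ~[𝓝[<] b] fun t => √(2 * c) * √(b - t) := by
  have hmem : Ioo a b ∈ 𝓝[<] b := Ioo_mem_nhdsLT hab
  have hquot : Tendsto (fun t => f t ^ 2 / (b - t)) (𝓝[<] b) (𝓝 (2 * c)) := by
    refine HasDerivAt.lhopital_zero_nhdsLT (f' := fun t => 2 * (f t * f' t)) (g' := fun _ => -1)
      ?_ ?_ ?_ ?_ ?_ ?_
    · filter_upwards [hmem] with t ht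
      simpa [mul_assoc] using (hf t ht).fun_pow 2
    · exact Eventually.of_forall fun t => by simpa using (hasDerivAt_id t).const_sub b
    · exact Eventually.of_forall fun t => by norm_num
    · simpa using hlim.pow 2
    · have : Tendsto (fun t : ℝ => b - t) (𝓝 b) (𝓝 (b - b)) :=
        (continuous_const.sub continuous_id).tendsto b
      rw [sub_self] at this
      exact this.mono_left nhdsWithin_le_nhds
    · have := (h.const_mul 2).neg
      simpa [div_neg] using this
  have hsqrt := hquot.sqrt
  have hγ : √(2 * c) ≠ 0 := (Real.sqrt_pos.2 (by positivity)).ne'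
  refine (isEquivalent_iff_tendsto_one ?_).2 ?_
  · filter_upwards [hmem] with t ht
    exact mul_ne_zero hγ (Real.sqrt_pos.2 (sub_pos.2 ht.2)).ne'
  · have h1 := hsqrt.div_const √(2 * c)
    rw [div_self hγ] at h1
    refine h1.congr' ?_
    filter_upwards [hmem] with t ht
    rw [Pi.div_apply, Real.sqrt_div (sq_nonneg _), Real.sqrt_sq (hpos t ht).le, div_div, mul_comm]

end SquareRoot

/-! ### Coalescence on the imaginary axis -/

/-- At a defective coalescence on the imaginary axis, the real part of the eigenvalue is
asymptotically proportional to the inner product of the left and right eigenvectors. -/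
theorem exists_tendsto_re_div_dotProduct {n : ℕ} {l : Filter ℝ} {M : ℝ → StateMatrix n}
    {Mhat : StateMatrix n} {lam : ℝ → ℂ} {lamhat : ℂ} {x y : ℝ → Fin n ⊕ Fin n → ℂ}
    (hMhat : Tendsto M l (𝓝 Mhat)) (hlamhat : Tendsto lam l (𝓝 lamhat))
    (hlamhat_re : lamhat.re = 0)
    (halg : (toComplex Mhat).charpoly.rootMultiplicity lamhat = 2)
    (hgeom : Module.finrank ℂ
      (Module.End.eigenspace (Matrix.toLin' (toComplex Mhat)) lamhat) = 1)
    (hpos : ∀ᶠ t in l, 0 < (lam t).re)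
    (hroot : ∀ᶠ t in l, (toComplex (M t)).charpoly.eval (lam t) = 0)
    (hroot' : ∀ᶠ t in l, (toComplex (M t)).charpoly.eval (-(starRingEnd ℂ (lam t))) = 0)
    (hxy : ∀ᶠ t in l, IsNormalizedEigenpair (M t) (lam t) (x t) (y t))
    (hsimple : ∀ᶠ t in l, (toComplex (M t)).charpoly.rootMultiplicity (lam t) = 1) :
    ∃ c : ℝ, 0 < c ∧ Tendsto (fun t => (lam t).re / (star (x t) ⬝ᵥ y t).re) l (𝓝 c) := by
  have hent : ∀ i j, Tendsto (fun t => toComplex (M t) i j) l (𝓝 (toComplex Mhat i j)) :=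
    fun i j => (Complex.continuous_ofReal.tendsto _).comp
      (tendsto_pi_nhds.1 (tendsto_pi_nhds.1 hMhat i) j)
  have hconj : -(starRingEnd ℂ lamhat) = lamhat := by
    apply Complex.ext <;> simp [hlamhat_re]
  have hneg : Tendsto (fun t => -(starRingEnd ℂ (lam t))) l (𝓝 lamhat) := by
    have := ((Complex.continuous_conj.tendsto _).comp hlamhat).neg
    rwa [hconj] at this
  obtain ⟨R, Rhat, hR0, hR, hRe⟩ := exists_tendsto_eval_derivative_charpoly hent hlamhat hneg halg
  have hadj : Tendsto (fun t => ‖(scalar _ (lam t) - toComplex (M t)).adjugate‖) l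
      (𝓝 ‖(scalar _ lamhat - toComplex Mhat).adjugate‖) := by
    have h1 : Tendsto (fun t => scalar _ (lam t) - toComplex (M t)) l
        (𝓝 (scalar _ lamhat - toComplex Mhat)) := by
      refine tendsto_pi_nhds.2 fun i => tendsto_pi_nhds.2 fun j => ?_
      rcases eq_or_ne i j with rfl | hij
      · simpa using hlamhat.sub (hent i i)
      · simpa [hij] using (hent i j).neg
    have h2 : Continuous fun A : Matrix (Fin n ⊕ Fin n) (Fin n ⊕ Fin n) ℂ => ‖A.adjugate‖ :=
      continuous_norm.comp continuous_id.matrix_adjugate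
    exact (h2.tendsto _).comp h1
  have hadj0 : (scalar _ lamhat - toComplex Mhat).adjugate ≠ 0 := by
    have hker : Module.End.eigenspace (Matrix.toLin' (toComplex Mhat)) lamhat =
        LinearMap.ker (scalar _ lamhat - toComplex Mhat).mulVecLin := by
      ext v
      rw [Module.End.mem_eigenspace_iff, LinearMap.mem_ker, Matrix.toLin'_apply,
        Matrix.mulVecLin_apply, Matrix.sub_mulVec, sub_eq_zero, eq_comm]
      have : (scalar (Fin n ⊕ Fin n) lamhat) *ᵥ v = lamhat • v := by
        ext i
        simp [Matrix.mulVec_diagonal]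
      rw [this]
    rw [hker] at hgeom
    have hrank := finrank_ker_mulVecLin_add_rank (scalar _ lamhat - toComplex Mhat)
    rw [hgeom] at hrank
    have : Nonempty (Fin n ⊕ Fin n) := by
      rw [← Fintype.card_pos_iff]
      omega
    exact (adjugate_ne_zero_iff _).2 hrank.ge
  -- The constant is the limit of Re λ/κ = ‖adj‖/(2|R|), obtained from |α| κ = 2 Re λ |R| and |α| =
  -- ‖adj‖.
  refine ⟨‖(scalar _ lamhat - toComplex Mhat).adjugate‖ / (2 * ‖Rhat‖), ?_,
    (hadj.div (hR.norm.const_mul 2) (by positivity)).congr' ?_⟩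
  · have := norm_pos_iff.2 hadj0
    positivity
  · filter_upwards [hpos, hroot, hroot', hxy, hsimple, hR.eventually_ne hR0] with
      t ht h1 h2 hxyt hst hRt
    obtain ⟨-, α, -, hα, hαn⟩ := hxyt.exists_adjugate_eq hst
    have hsub : lam t - -(starRingEnd ℂ (lam t)) = ((2 * (lam t).re : ℝ) : ℂ) := by
      rw [sub_neg_eq_add, Complex.add_conj]
    rw [hRe t h1 h2 (by
      rw [← sub_ne_zero, hsub, Complex.ofReal_ne_zero]
      positivity), hsub, hxyt.dotProduct_eq] at hα
    have hn := congrArg norm hα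
    have hκ := hxyt.re_pos
    rw [norm_mul, norm_mul, Complex.norm_of_nonneg hκ.le,
      Complex.norm_of_nonneg (by positivity)] at hn
    have hRn := norm_pos_iff.2 hRt
    rw [Pi.div_apply, hαn, div_eq_div_iff (by positivity) hκ.ne', hn]
    ring

end Passivation
end

/-! ### The square root law -/

theorem mainTheorem6 {n p m k l : ℕ} (ν : PassivityNotion p m) (X : SystemMatrix n p m)
    (L : Matrix (Fin k) (Fin l) ℝ →ₗ[ℝ] SystemMatrix n p m)
    (ε₀ εhat : ℝ) (hε₀ : 0 ≤ ε₀) (hε : ε₀ < εhat)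
    (E : ℝ → Matrix (Fin k) (Fin l) ℝ) (lam : ℝ → ℂ) (x y : ℝ → Fin n ⊕ Fin n → ℂ)
    (M : ℝ → StateMatrix n) (hM : ∀ ε, M ε = ν.hamiltonian (X + L (ε • E ε)))
    (G : ℝ → Matrix (Fin k) (Fin l) ℝ) (hG : ∀ ε, G ε = freeGradient ν X L ε (E ε) (x ε) (y ε))
    -- `M` is defined along the path of perturbed systems
    (hadm : ∀ ε ∈ Ioo ε₀ εhat, ν.Admissible (X + L (ε • E ε)))
    -- `E(ε)` is a local minimizer of `φ_ε` on the unit sphere of the Frobenius norm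
    (hnorm : ∀ ε ∈ Ioo ε₀ εhat, ‖E ε‖ = 1)
    (hmin : ∀ ε ∈ Ioo ε₀ εhat, IsLocalMinOn (phi ν X L ε) {F | ‖F‖ = 1} (E ε))
    -- `λ(ε)`, its positivity to the left of `εhat`, and the normalized eigenvectors
    (hlam : ∀ ε ∈ Ioo ε₀ εhat, IsLeadingEigenvalue (M ε) (lam ε))
    (hpos : ∀ ε ∈ Ioo ε₀ εhat, 0 < (lam ε).re)
    (hxy : ∀ ε ∈ Ioo ε₀ εhat, IsNormalizedEigenpair (M ε) (lam ε) (x ε) (y ε))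
    -- first assumption: uniqueness, simplicity, smoothness
    (huniq : ∀ ε ∈ Ioo ε₀ εhat, ∀ μ ∈ spectrum ℂ (toComplex (M ε)),
      μ.re = (lam ε).re → 0 ≤ μ.im → μ = lam ε)
    (hsimple : ∀ ε ∈ Ioo ε₀ εhat, (toComplex (M ε)).charpoly.rootMultiplicity (lam ε) = 1)
    (hE_smooth : ContDiffOn ℝ ∞ E (Ioo ε₀ εhat))
    (hlam_smooth : ContDiffOn ℝ ∞ lam (Ioo ε₀ εhat))
    -- second assumption: nonzero gradient, with a nonzero limit
    (hG_ne : ∀ ε ∈ Ioo ε₀ εhat, G ε ≠ 0)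
    (Ghat : Matrix (Fin k) (Fin l) ℝ) (hGhat : Tendsto G (𝓝[<] εhat) (𝓝 Ghat))
    (hGhat_ne : Ghat ≠ 0)
    -- third assumption: defective coalescence of two eigenvalues on the imaginary axis
    (Mhat : StateMatrix n) (lamhat : ℂ)
    (hMhat : Tendsto M (𝓝[<] εhat) (𝓝 Mhat))
    (hlamhat : Tendsto lam (𝓝[<] εhat) (𝓝 lamhat)) (hlamhat_re : lamhat.re = 0)
    (halg : (toComplex Mhat).charpoly.rootMultiplicity lamhat = 2)
    (hgeom : Module.finrank ℂ
      (Module.End.eigenspace (Matrix.toLin' (toComplex Mhat)) lamhat) = 1)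
    -- nondegeneracy condition
    (hnondeg : NondegeneracyCondition ε₀ εhat M x y) :
    ∃ γ : ℝ, 0 < γ ∧
      (fun ε => (lam ε).re) ~[𝓝[<] εhat] (fun ε => γ * √(εhat - ε)) := by
  have hmem : Ioo ε₀ εhat ∈ 𝓝[<] εhat := Ioo_mem_nhdsLT hε
  have hroot : ∀ ε ∈ Ioo ε₀ εhat, (toComplex (M ε)).charpoly.eval (lam ε) = 0 := fun ε h =>
    Matrix.mem_spectrum_iff_isRoot_charpoly.1 (hlam ε h).1
  have hroot' : ∀ ε ∈ Ioo ε₀ εhat,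
      (toComplex (M ε)).charpoly.eval (-(starRingEnd ℂ (lam ε))) = 0 := by
    intro ε h
    obtain ⟨a, b, c, hb, hc, heq⟩ := ν.exists_hamiltonian_eq_fromBlocks (X + L (ε • E ε))
    have h1 := hroot ε h
    rw [hM, heq] at h1 ⊢
    exact eval_charpoly_neg_conj_eq_zero hb hc h1
  obtain ⟨c, hc, hctend⟩ := exists_tendsto_re_div_dotProduct hMhat hlamhat hlamhat_re halg hgeom
    (eventually_of_mem hmem hpos) (eventually_of_mem hmem hroot) (eventually_of_mem hmem hroot')
    (eventually_of_mem hmem hxy) (eventually_of_mem hmem hsimple)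
  set κ : ℝ → ℝ := fun ε => (star (x ε) ⬝ᵥ y ε).re with hκ
  have hκ0 : ∀ ε ∈ Ioo ε₀ εhat, 0 < κ ε := fun ε h => (hxy ε h).re_pos
  have hlamd : ∀ ε ∈ Ioo ε₀ εhat, HasDerivAt lam (deriv lam ε) ε := fun ε h =>
    ((hlam_smooth.differentiableOn (by simp)).differentiableAt (Ioo_mem_nhds h.1 h.2)).hasDerivAt
  have hfd : ∀ ε ∈ Ioo ε₀ εhat, HasDerivAt (fun ε => (lam ε).re) (deriv lam ε).re ε := fun ε h =>
    Complex.reCLM.hasFDerivAt.comp_hasDerivAt ε (hlamd ε h)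
  have hstat : ∀ ε ∈ Ioo ε₀ εhat, ∀ V, frobInner (E ε) V = 0 → frobInner V (G ε) = 0 := by
    intro ε h V hV
    have hM' := hM ε
    rw [hG]
    exact frobInner_freeGradient_eq_zero ν X L (hε₀.trans_lt h.1) (hadm ε h) (hnorm ε h)
      (hmin ε h) (hM' ▸ hlam ε h) (hpos ε h) (hM' ▸ hxy ε h) (hM' ▸ hsimple ε h) hV
  have hderiv : ∀ ε ∈ Ioo ε₀ εhat, (deriv lam ε).re * κ ε = frobInner (E ε) (G ε) := by
    intro ε h
    have hM' := hM ε
    have hnhds : Ioo ε₀ εhat ∈ 𝓝 ε := Ioo_mem_nhds h.1 h.2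
    have hEd : HasDerivAt E (deriv E ε) ε :=
      ((hE_smooth.differentiableOn (by simp)).differentiableAt hnhds).hasDerivAt
    -- Since E stays on the sphere, E' is tangential; stationarity then removes its contribution to
    -- the derivative of λ.
    have horth : frobInner (E ε) (deriv E ε) = 0 := by
      have h1 : HasDerivAt (fun t => frobInner (E t) (E t)) 0 ε := by
        refine (hasDerivAt_const ε (1 : ℝ)).congr_of_eventuallyEq ?_
        filter_upwards [hnhds] with t ht
        rw [← norm_sq_eq_frobInner, hnorm t ht, one_pow]
      have h2 := (hasDerivAt_frobInner_self hEd).unique h1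
      linarith
    have h3 := re_mul_eq_frobInner_freeGradient ν X L hEd (hlamd ε h) (hadm ε h)
      (by
        filter_upwards [hnhds] with t ht
        rw [← hM]
        exact hroot t ht)
      (hM' ▸ hxy ε h) (hM' ▸ hsimple ε h)
    rw [← hG, frobInner_add_left, frobInner_smul_left, hstat ε h _ horth, mul_zero, add_zero] at h3
    exact h3
  have hsq : ∀ ε ∈ Ioo ε₀ εhat, ((deriv lam ε).re * κ ε) ^ 2 = ‖G ε‖ ^ 2 := fun ε h => by
    rw [hderiv ε h, sq_frobInner_eq_norm_sq (hnorm ε h) (hstat ε h)]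
  have hre : Tendsto (fun ε => (lam ε).re) (𝓝[<] εhat) (𝓝 0) := by
    rw [← hlamhat_re]
    exact (Complex.continuous_re.tendsto _).comp hlamhat
  have hneg : ∀ ε ∈ Ioo ε₀ εhat, (deriv lam ε).re < 0 := by
    refine deriv_neg_of_tendsto_zero hε hfd hpos (fun ε h h0 => hG_ne ε h ?_) hre
    have h1 := hsq ε h
    rw [h0, zero_mul, zero_pow two_ne_zero, eq_comm, sq_eq_zero_iff] at h1
    exact norm_eq_zero.1 h1
  have hG_eq : ∀ ε ∈ Ioo ε₀ εhat, (deriv lam ε).re = -(‖G ε‖ / κ ε) := by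
    intro ε h
    have h1 : (-((deriv lam ε).re * κ ε)) ^ 2 = ‖G ε‖ ^ 2 := by rw [neg_sq, hsq ε h]
    have h2 : -((deriv lam ε).re * κ ε) = ‖G ε‖ :=
      (pow_left_inj₀ (by nlinarith [hneg ε h, hκ0 ε h]) (norm_nonneg _) two_ne_zero).1 h1
    have := (hκ0 ε h).ne'
    rw [← h2]
    field_simp
  have hGn : 0 < ‖Ghat‖ := norm_pos_iff.2 hGhat_ne
  refine ⟨√(2 * (c * ‖Ghat‖)), Real.sqrt_pos.2 (by positivity),
    isEquivalent_sqrt hε (by positivity) hfd hpos hre ?_⟩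
  have hGlim : Tendsto (fun ε => ‖G ε‖) (𝓝[<] εhat) (𝓝 ‖Ghat‖) :=
    (continuous_norm.tendsto Ghat).comp hGhat
  -- With f' = -‖G‖/κ, the product f f' equals -(f/κ)‖G‖.
  refine (hctend.mul hGlim).neg.congr' ?_
  filter_upwards [hmem] with ε h
  rw [hG_eq ε h]
  ring
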